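/- Let $X$ be an undirected, simple, reflexive graph (with an arbitrary, possibly infinite, vertex set), and let $cl(v)$ denote the set consisting of $v$ and the vertices adjacent to it. Let $VR(X)$ be the simplicial complex whose simplices are the nonempty finite sets $\sigma$ of vertices with $v\in cl(w)$ for all $v,w\in\sigma$, and let $|VR(X)|$ be its geometric realization with the weak topology. Let $R(X)$ be the Čech closure space on the same underlying set in which the neighborhoods of a vertex $v$ are the sets that contain $\bigcup_{v\in\sigma}|\sigma|$, while the neighborhoods of a point that is not a vertex are its neighborhoods in $|VR(X)|$. A map of closure spaces $f:(Y,c)\to(Z,c')$ is continuous if $f(c(A))\subseteq c'(f(A))$ for all $A\subseteq Y$; topological spaces are closure spaces through their closure operation. A homotopy is a continuous map on the product closure space $Y\times[0,1]$. For a closure space $Z$, a point $p\in Z$ and $*\in S^n$, let $\pi_n(Z,p)$ be the set of based homotopy classes of continuous based maps $(S^n,*)\to(Z,p)$. The identity map $1:|VR(X)|\to R(X)$ is continuous. Theorem. For every $n\ge 0$: 1. Every continuous map $f:S^n\to R(X)$ is homotopic in $R(X)$ to $1\circ g$ for some continuous map $g:S^n\to|VR(X)|$. 2. For every $*\in S^n$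 and every point $p$ of $|VR(X)|$, every continuous based map $f:(S^n,*)\to(R(X),p)$ is homotopic, by a homotopy that keeps the base point fixed, to $1\circ g$ for some continuous based map $g:(S^n,*)\to(|VR(X)|,p)$. Hence the induced map $\pi_n(1):\pi_n(|VR(X)|,p)\to\pi_n(R(X),p)$ is surjective. -/

import Mathlib

open Filter Topology

/-- A (Čech) closure operation on a set `X`. -/
structure CechClosure (X : Type*) where
  /-- the closure operation -/
  cl : Set X → Set X
  cl_empty : cl ∅ = ∅
  subset_cl : ∀ A, A ⊆ cl A
  cl_union : ∀ A B, cl (A ∪ B) = cl A ∪ cl B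

namespace CechClosure

variable {X Y Z : Type*}

theorem cl_mono (c : CechClosure X) {A B : Set X} (h : A ⊆ B) : c.cl A ⊆ c.cl B := by
  have h1 := c.cl_union A B
  rw [Set.union_eq_self_of_subset_left h] at h1
  rw [h1]
  exact Set.subset_union_left

/-- The neighborhood system of a point: `U` is a neighborhood of `x` iff `x ∉ c (X ∖ U)`. -/
def nhd (c : CechClosure X) (x : X) : Filter X where
  sets := {U | x ∉ c.cl Uᶜ}
  univ_sets := by simp [c.cl_empty]
  sets_of_superset := fun {_ _} hU hUV h => hU (c.cl_mono (Set.compl_subset_compl.2 hUV) h)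
  inter_sets := fun {U V} hU hV => by
    simp only [Set.mem_ofPred_eq, Set.compl_inter, c.cl_union, Set.mem_union, not_or] at *
    exact ⟨hU, hV⟩

theorem mem_nhd (c : CechClosure X) {x : X} {U : Set X} : U ∈ c.nhd x ↔ x ∉ c.cl Uᶜ := Iff.rfl

theorem pure_le_nhd (c : CechClosure X) (x : X) : pure x ≤ c.nhd x := by
  intro U hU
  by_contra h
  exact hU (c.subset_cl _ h)

/-- The closure operation with a prescribed neighborhood filter `N x` at every point `x`:
a point is in the closure of `A` iff each of its neighborhoods meets `A`. -/
def ofNhds (N : X → Filter X) (hN : ∀ x, pure x ≤ N x) : CechClosure X where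
  cl A := {x | ∀ U ∈ N x, (U ∩ A).Nonempty}
  cl_empty := by
    ext x
    simpa using ⟨Set.univ, univ_mem⟩
  subset_cl := fun A x hx U hU => ⟨x, hN x hU, hx⟩
  cl_union := fun A B => by
    ext x
    constructor
    · intro h
      by_contra h'
      simp only [Set.mem_union, Set.mem_ofPred_eq, not_or, not_forall] at h'
      obtain ⟨⟨U, hU, hUA⟩, ⟨W, hW, hWB⟩⟩ := h'
      obtain ⟨y, ⟨hyU, hyW⟩, hy | hy⟩ := h (U ∩ W) (inter_mem hU hW)
      · exact hUA ⟨y, hyU, hy⟩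
      · exact hWB ⟨y, hyW, hy⟩
    · rintro (h | h) U hU
      · exact (h U hU).mono (Set.inter_subset_inter_right _ Set.subset_union_left)
      · exact (h U hU).mono (Set.inter_subset_inter_right _ Set.subset_union_right)

theorem nhd_ofNhds (N : X → Filter X) (hN : ∀ x, pure x ≤ N x) (x : X) :
    (ofNhds N hN).nhd x = N x := by
  ext U
  rw [mem_nhd]
  simp only [ofNhds, Set.mem_ofPred_eq, not_forall]
  constructor
  · rintro ⟨W, hW, h⟩
    refine mem_of_superset hW fun y hy => ?_
    by_contra hyU
    exact h ⟨y, hy, hyU⟩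
  · exact fun hU => ⟨U, hU, by simp⟩

/-- The closure operation of a topological space. -/
def ofTop (X : Type*) [TopologicalSpace X] : CechClosure X where
  cl := closure
  cl_empty := closure_empty
  subset_cl := fun _ => subset_closure
  cl_union := fun _ _ => closure_union

theorem nhd_ofTop [TopologicalSpace X] (x : X) : (ofTop X).nhd x = 𝓝 x := by
  ext U
  rw [mem_nhd, ← mem_interior_iff_mem_nhds, interior_eq_compl_closure_compl]
  rfl

/-- Continuity of a map between closure spaces: `f (c A) ⊆ d (f A)` for every `A`. -/
def Continuous (c : CechClosure X) (d : CechClosure Y) (f : X → Y) : Prop :=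
  ∀ A, f '' c.cl A ⊆ d.cl (f '' A)

theorem continuous_iff {c : CechClosure X} {d : CechClosure Y} {f : X → Y} :
    c.Continuous d f ↔ ∀ x, Tendsto f (c.nhd x) (d.nhd (f x)) := by
  constructor
  · intro h x U hU hx
    exact hU (d.cl_mono (by rintro _ ⟨y, hy, rfl⟩; exact hy) (h _ ⟨x, hx, rfl⟩))
  · rintro h A _ ⟨x, hx, rfl⟩
    by_contra hfx
    have h1 : (f '' A)ᶜ ∈ d.nhd (f x) := by rwa [mem_nhd, compl_compl]
    refine h x h1 (c.cl_mono (fun y hy => ?_) hx)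
    simpa using ⟨y, hy, rfl⟩

theorem Continuous.comp {c : CechClosure X} {d : CechClosure Y} {e : CechClosure Z}
    {g : Y → Z} {f : X → Y} (hg : d.Continuous e g) (hf : c.Continuous d f) :
    c.Continuous e (g ∘ f) :=
  continuous_iff.2 fun x => (continuous_iff.1 hg (f x)).comp (continuous_iff.1 hf x)

/-- The product closure structure: the neighborhoods of `(x, y)` are generated by the products
`U × W` of neighborhoods `U` of `x` and `W` of `y`. -/
def prod (c : CechClosure X) (d : CechClosure Y) : CechClosure (X × Y) :=
  ofNhds (fun p => c.nhd p.1 ×ˢ d.nhd p.2) fun p => by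
    rw [← Prod.mk.eta (p := p), ← prod_pure_pure]
    exact Filter.prod_mono (c.pure_le_nhd _) (d.pure_le_nhd _)

theorem nhd_prod (c : CechClosure X) (d : CechClosure Y) (p : X × Y) :
    (c.prod d).nhd p = c.nhd p.1 ×ˢ d.nhd p.2 :=
  nhd_ofNhds _ _ p

/-- Two maps `f g : (X, c) → (Y, d)` are homotopic: there is a continuous `H : X × I → Y` with
`H (x, 0) = f x` and `H (x, 1) = g x`. -/
def Homotopic (c : CechClosure X) (d : CechClosure Y) (f g : X → Y) : Prop :=
  ∃ H : X × unitInterval → Y, (c.prod (ofTop unitInterval)).Continuous d H ∧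
    (∀ x, H (x, 0) = f x) ∧ ∀ x, H (x, 1) = g x

/-- A based map `(X, s) → (Y, p)` between closure spaces. -/
structure BasedMap (c : CechClosure X) (s : X) (d : CechClosure Y) (p : Y) where
  /-- the underlying map -/
  toFun : X → Y
  continuous : c.Continuous d toFun
  map_base : toFun s = p

/-- Composition of a based map with a continuous map. -/
def BasedMap.postcomp {c : CechClosure X} {s : X} {d : CechClosure Y} {p : Y}
    {e : CechClosure Z} {q : Z} (f : BasedMap c s d p) (h : BasedMap d p e q) :
    BasedMap c s e q where
  toFun := h.toFun ∘ f.toFun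
  continuous := h.continuous.comp f.continuous
  map_base := by simp [f.map_base, h.map_base]

/-- Based homotopy of based maps: a homotopy which maps the base point to the base point at all
times. -/
def BasedMap.Homotopic {c : CechClosure X} {s : X} {d : CechClosure Y} {p : Y}
    (f g : BasedMap c s d p) : Prop :=
  ∃ H : X × unitInterval → Y, (c.prod (ofTop unitInterval)).Continuous d H ∧
    (∀ x, H (x, 0) = f.toFun x) ∧ (∀ x, H (x, 1) = g.toFun x) ∧ ∀ t, H (s, t) = p

theorem continuous_prod_iff {c : CechClosure X} {d : CechClosure Y}
    {H : X × unitInterval → Y} :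
    (c.prod (ofTop unitInterval)).Continuous d H ↔
      ∀ x t, Tendsto H (c.nhd x ×ˢ 𝓝 t) (d.nhd (H (x, t))) := by
  simp only [continuous_iff, nhd_prod, nhd_ofTop, Prod.forall]

namespace BasedMap

variable {c : CechClosure X} {s : X} {d : CechClosure Y} {p : Y}

theorem Homotopic.refl (f : BasedMap c s d p) : f.Homotopic f := by
  refine ⟨fun q => f.toFun q.1, continuous_prod_iff.2 fun x t => ?_, fun _ => rfl, fun _ => rfl,
    fun _ => f.map_base⟩
  exact (continuous_iff.1 f.continuous x).comp tendsto_fst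

theorem Homotopic.symm {f g : BasedMap c s d p} (h : f.Homotopic g) : g.Homotopic f := by
  obtain ⟨H, hH, h0, h1, hs⟩ := h
  refine ⟨fun q => H (q.1, unitInterval.symm q.2), continuous_prod_iff.2 fun x t => ?_,
    fun x => by simpa using h1 x, fun x => by simpa using h0 x, fun t => hs _⟩
  exact (continuous_prod_iff.1 hH x (unitInterval.symm t)).comp
    (tendsto_fst.prodMk ((unitInterval.continuous_symm.tendsto t).comp tendsto_snd))

theorem Homotopic.trans {f g k : BasedMap c s d p} (h : f.Homotopic g) (h' : g.Homotopic k) :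
    f.Homotopic k := by
  classical
  obtain ⟨H, hH, h0, h1, hs⟩ := h
  obtain ⟨K, hK, k0, k1, ks⟩ := h'
  let a : unitInterval → unitInterval := fun t => Set.projIcc 0 1 zero_le_one (2 * (t : ℝ))
  let b : unitInterval → unitInterval := fun t => Set.projIcc 0 1 zero_le_one (2 * (t : ℝ) - 1)
  have ha : _root_.Continuous a := continuous_projIcc.comp (by fun_prop)
  have hb : _root_.Continuous b := continuous_projIcc.comp (by fun_prop)
  have hHa : ∀ x t, Tendsto (fun q : X × unitInterval => H (q.1, a q.2)) (c.nhd x ×ˢ 𝓝 t)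
      (d.nhd (H (x, a t))) := fun x t => (continuous_prod_iff.1 hH x (a t)).comp
    (tendsto_fst.prodMk ((ha.tendsto t).comp tendsto_snd))
  have hKb : ∀ x t, Tendsto (fun q : X × unitInterval => K (q.1, b q.2)) (c.nhd x ×ˢ 𝓝 t)
      (d.nhd (K (x, b t))) := fun x t => (continuous_prod_iff.1 hK x (b t)).comp
    (tendsto_fst.prodMk ((hb.tendsto t).comp tendsto_snd))
  refine ⟨fun q => if (q.2 : ℝ) ≤ 1 / 2 then H (q.1, a q.2) else K (q.1, b q.2),
    continuous_prod_iff.2 fun x t => ?_, fun x => ?_, fun x => ?_, fun t => ?_⟩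
  · rcases lt_trichotomy (t : ℝ) (1 / 2) with ht | ht | ht
    · have he : ∀ᶠ q in c.nhd x ×ˢ 𝓝 t, (q.2 : ℝ) < 1 / 2 :=
        tendsto_snd.eventually
          ((continuous_subtype_val.tendsto t).eventually (gt_mem_nhds ht))
      simp only [ht.le, if_true]
      refine (hHa x t).congr' ?_
      filter_upwards [he] with q hq
      simp [show (q.2 : ℝ) ≤ 2⁻¹ by linarith]
    · have hat : a t = 1 := Set.projIcc_of_right_le _ (by linarith)
      have hbt : b t = 0 := Set.projIcc_of_le_left _ (by linarith)
      have e1 := hHa x t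
      have e2 := hKb x t
      rw [hat, h1] at e1
      rw [hbt, k0] at e2
      simp only [ht.le, if_true, hat, h1]
      exact Tendsto.if' e1 e2
    · have he : ∀ᶠ q in c.nhd x ×ˢ 𝓝 t, 1 / 2 < (q.2 : ℝ) :=
        tendsto_snd.eventually
          ((continuous_subtype_val.tendsto t).eventually (lt_mem_nhds ht))
      simp only [not_le.2 ht, if_false]
      refine (hKb x t).congr' ?_
      filter_upwards [he] with q hq
      simp [show ¬ (q.2 : ℝ) ≤ 2⁻¹ by linarith]
  · have : a 0 = 0 := Set.projIcc_of_le_left _ (by simp)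
    simp [this, h0]
  · have : b 1 = 1 := Set.projIcc_of_right_le _ (by norm_num)
    norm_num [this, k1]
  · simp [hs, ks]

/-- Based homotopy as an equivalence relation. -/
def setoid (c : CechClosure X) (s : X) (d : CechClosure Y) (p : Y) :
    Setoid (BasedMap c s d p) where
  r := Homotopic
  iseqv := ⟨Homotopic.refl, Homotopic.symm, Homotopic.trans⟩

theorem Homotopic.postcomp {Z : Type*} {e : CechClosure Z} {q : Z} {f g : BasedMap c s d p}
    (hfg : f.Homotopic g) (h : BasedMap d p e q) :
    (f.postcomp h).Homotopic (g.postcomp h) := by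
  obtain ⟨H, hH, h0, h1, hs⟩ := hfg
  exact ⟨h.toFun ∘ H, h.continuous.comp hH, fun x => congrArg h.toFun (h0 x),
    fun x => congrArg h.toFun (h1 x), fun t => by simp [hs, h.map_base]⟩

end BasedMap

/-- The unit sphere `S^n` in `ℝ^(n+1)`. -/
abbrev Sphere (n : ℕ) : Type := Metric.sphere (0 : EuclideanSpace ℝ (Fin (n + 1))) 1

/-- `π_n (Y, p)`: the based homotopy classes of based maps `(S^n, s) → (Y, p)`. -/
def HomotopyClasses (n : ℕ) (s : Sphere n) (d : CechClosure Y) (p : Y) : Type _ :=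
  Quotient (BasedMap.setoid (ofTop (Sphere n)) s d p)

/-- The map `π_n (Y, p) → π_n (Z, q)` induced by a based map `h : (Y, p) → (Z, q)`. -/
def HomotopyClasses.map (n : ℕ) (s : Sphere n) {d : CechClosure Y} {p : Y} {e : CechClosure Z} {q : Z}
    (h : BasedMap d p e q) : HomotopyClasses n s d p → HomotopyClasses n s e q :=
  Quotient.map' (fun f => f.postcomp h) fun _ _ hfg => BasedMap.Homotopic.postcomp hfg h

end CechClosure

section Realization

variable {V : Type*}

/-- The set of points of the geometric realization of a simplicial complex, in barycentric
coordinates. -/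
def Realization (K : AbstractSimplicialComplex V) : Type _ :=
  {x : V →₀ ℝ // (∀ v, 0 ≤ x v) ∧ (∑ v ∈ x.support, x v) = 1 ∧ x.support ∈ K.faces}

namespace Realization

variable {K : AbstractSimplicialComplex V}

/-- The closed simplex `|σ|` in the realization. -/
def closedSimplex (K : AbstractSimplicialComplex V) (σ : Finset V) : Set (Realization K) :=
  {x | x.1.support ⊆ σ}

/-- The Euclidean topology of the closed simplex `|σ|`, given by its barycentric coordinates
in `ℝ^σ`. -/
@[reducible]
def simplexTopology (K : AbstractSimplicialComplex V) (σ : Finset V) :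
    TopologicalSpace (closedSimplex K σ) :=
  TopologicalSpace.induced (fun x (v : σ) => x.1.1 v) inferInstance

/-- The weak topology of the geometric realization: a set is open iff its intersection with every
closed simplex `|σ|` is open in the Euclidean topology of `|σ|`. -/
instance : TopologicalSpace (Realization K) :=
  ⨆ σ : K.faces, TopologicalSpace.coinduced Subtype.val (simplexTopology K σ)

theorem isOpen_iff {U : Set (Realization K)} :
    IsOpen U ↔ ∀ σ ∈ K.faces,
      IsOpen[simplexTopology K σ] (Subtype.val ⁻¹' U : Set (closedSimplex K σ)) := by
  refine isOpen_iSup_iff.trans ?_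
  simp only [isOpen_coinduced, Subtype.forall]

/-- The point of the realization given by a vertex. -/
noncomputable def vertex (K : AbstractSimplicialComplex V) (v : V) : Realization K :=
  ⟨Finsupp.single v 1, fun w => by
    classical
    rw [Finsupp.single_apply]
    split_ifs <;> norm_num, by
    rw [Finsupp.support_single _ one_ne_zero]
    simp, by
    rw [Finsupp.support_single _ one_ne_zero]
    exact K.singleton_mem v⟩

theorem vertex_injective (K : AbstractSimplicialComplex V) : Function.Injective (vertex K) :=
  fun _ _ h => Finsupp.single_left_injective one_ne_zero (congrArg Subtype.val h)

/-- The union `⋃_{v ∈ σ} |σ|` of the closed simplices with vertex `v`. -/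
def closedStar (K : AbstractSimplicialComplex V) (v : V) : Set (Realization K) :=
  ⋃ σ ∈ {σ | σ ∈ K.faces ∧ v ∈ σ}, closedSimplex K σ

theorem vertex_mem_closedStar (v : V) : vertex K v ∈ closedStar K v := by
  refine Set.mem_biUnion (x := {v}) ⟨K.singleton_mem v, by simp⟩ ?_
  exact (Finsupp.support_single _ one_ne_zero).subset

theorem continuous_coord (v : V) : Continuous fun x : Realization K => x.1 v := by
  refine continuous_def.2 fun U hU => isOpen_iff.2 fun σ _ => ?_
  let := simplexTopology K σ
  have h : Continuous fun x : closedSimplex K σ => x.1.1 v := by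
    by_cases hv : v ∈ σ
    · have hi : Continuous fun (x : closedSimplex K σ) (w : σ) => x.1.1 w :=
        continuous_induced_dom
      exact continuous_pi_iff.1 hi ⟨v, hv⟩
    · have : (fun x : closedSimplex K σ => x.1.1 v) = fun _ => 0 := by
        ext x
        exact Finsupp.notMem_support_iff.1 fun h => hv (x.2 h)
      rw [this]
      exact continuous_const
  exact hU.preimage h

theorem closedStar_mem_nhds (v : V) : closedStar K v ∈ 𝓝 (vertex K v) := by
  have h : ∀ᶠ x : Realization K in 𝓝 (vertex K v), 0 < x.1 v :=
    (continuous_coord v).continuousAt.eventually (lt_mem_nhds (by simp [vertex]))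
  filter_upwards [h] with x hx
  exact Set.mem_biUnion (x := x.1.support)
    ⟨x.2.2.2, Finsupp.mem_support_iff.2 hx.ne'⟩ (Finset.Subset.refl _)

end Realization

end Realization

namespace SimpleGraph

open Realization

variable {V : Type*}

/-- The canonical closure structure of a graph (every vertex is taken to carry a loop): the closure
of `A` consists of the vertices which are equal or adjacent to an element of `A`. -/
def cechClosure (G : SimpleGraph V) : CechClosure V where
  cl A := {w | ∃ v ∈ A, v = w ∨ G.Adj v w}
  cl_empty := by simp
  subset_cl := fun _ v hv => ⟨v, hv, Or.inl rfl⟩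
  cl_union := fun A B => by
    ext w
    simp only [Set.mem_union, Set.mem_ofPred_eq, or_and_right, exists_or]

/-- The Vietoris-Rips (clique) complex of a graph: its simplices are the nonempty finite sets of
vertices such that each vertex is in the closure of each other. -/
def vietorisRips (G : SimpleGraph V) : AbstractSimplicialComplex V where
  faces := {σ | σ.Nonempty ∧ ∀ v ∈ σ, ∀ w ∈ σ, v ∈ G.cechClosure.cl {w}}
  isRelLowerSet_faces := fun _ hσ =>
    ⟨hσ.1, fun _ hτσ hτ => ⟨hτ, fun v hv w hw => hσ.2 v (hτσ hv) w (hτσ hw)⟩⟩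
  singleton_mem := fun v => ⟨by simp, fun a ha b hb => by
    rw [Finset.mem_singleton.1 ha, Finset.mem_singleton.1 hb]
    exact G.cechClosure.subset_cl _ rfl⟩

/-- The underlying set of `|VR(G)|` and of `R(G)`. -/
abbrev VR (G : SimpleGraph V) : Type _ := Realization G.vietorisRips

/-- The topological closure structure on `|VR(G)|`. -/
def closureVR (G : SimpleGraph V) : CechClosure G.VR := CechClosure.ofTop G.VR

open Classical in
/-- The neighborhood filters of `R(G)`: at a vertex `v` the filter generated by the closed star
`⋃_{v ∈ σ} |σ|`, and at every other point the neighborhood filter of `|VR(G)|`. -/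
noncomputable def nhdR (G : SimpleGraph V) (x : G.VR) : Filter G.VR :=
  if h : ∃ v, vertex G.vietorisRips v = x then 𝓟 (closedStar G.vietorisRips h.choose) else 𝓝 x

theorem nhdR_vertex (G : SimpleGraph V) (v : V) :
    G.nhdR (vertex G.vietorisRips v) = 𝓟 (closedStar G.vietorisRips v) := by
  have h : ∃ w, vertex G.vietorisRips w = vertex G.vietorisRips v := ⟨v, rfl⟩
  rw [nhdR, dif_pos h, vertex_injective _ h.choose_spec]

theorem nhdR_of_ne_vertex (G : SimpleGraph V) (x : G.VR)
    (h : ∀ v, vertex G.vietorisRips v ≠ x) : G.nhdR x = 𝓝 x :=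
  dif_neg (by simpa using h)

theorem nhds_le_nhdR (G : SimpleGraph V) (x : G.VR) : 𝓝 x ≤ G.nhdR x := by
  by_cases h : ∃ v, vertex G.vietorisRips v = x
  · obtain ⟨v, rfl⟩ := h
    rw [nhdR_vertex]
    exact le_principal_iff.2 (closedStar_mem_nhds v)
  · rw [nhdR_of_ne_vertex G x (by simpa using h)]

/-- The closure structure of `R(G)`, on the underlying set of `|VR(G)|`. -/
noncomputable def closureR (G : SimpleGraph V) : CechClosure G.VR :=
  CechClosure.ofNhds G.nhdR fun x => (pure_le_nhds x).trans (G.nhds_le_nhdR x)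

theorem continuous_id_VR_R (G : SimpleGraph V) : G.closureVR.Continuous G.closureR id :=
  CechClosure.continuous_iff.2 fun x => by
    rw [closureVR, closureR, CechClosure.nhd_ofTop, CechClosure.nhd_ofNhds]
    exact G.nhds_le_nhdR x

/-- The identity map `|VR(G)| → R(G)`, based at a point `p`. -/
def idVR (G : SimpleGraph V) (p : G.VR) :
    CechClosure.BasedMap G.closureVR p G.closureR p where
  toFun := id
  continuous := G.continuous_id_VR_R
  map_base := rfl

end SimpleGraph

/-! ### Weak topology: coordinatewise convergence and compact sets -/

namespace Realization

variable {V : Type*} {K : AbstractSimplicialComplex V}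

/-! A continuous `f` into `R(G)` is only coarsely controlled where it hits vertices, but that
suffices for a nerve-type approximation. Pick a vertex `ψ y` in the support of each `f y`; some ball
of radius `δ y` about `y` is mapped into the closed star of `ψ y`. If the half-radius balls about
`x` and `x'` meet, the ball of the larger radius contains both centers, so `ψ x` and `ψ x'` are
equal or adjacent. In a clique complex pairwise adjacency is enough: a finite family of bump
functions on half-radius balls, used as weights on the vertices `ψ x`, gives a continuous `g` into
`|VR(G)|`, and `g y` lies in a common simplex with `f y`.

The straight-line homotopy from `f` to `g` need not be continuous where `f` is not continuous into
`|VR(G)|`. Over a closed set `C` containing all such points, it is replaced during the middle third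
of time by the vertex `ψ y`. Continuity at a vertex of `R(G)` only asks that nearby values lie in
its closed star, and they do. Outside the middle third the homotopy over `C` is `f` or `g`.

For the base point `s` there are two cases. If `f s` is a vertex, the radii are chosen so that only
the bump at `s` is positive there. Otherwise `f` is continuous into `|VR(G)|` near `s`, and `f`
itself enters the weighted sum, with a weight `α` supported near `s`, as the only term at `s`.
Continuity of this mixture uses that compact sets in the weak topology involve finitely many
vertices (`exists_finset_of_isCompact`), which reduces convergence to coordinates
(`tendsto_of_coord`). -/

theorem exists_mem_support (x : Realization K) : ∃ v, v ∈ x.1.support := by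
  by_contra! h
  have h1 := x.2.2.1
  rw [Finset.eq_empty_of_forall_notMem h] at h1
  simp at h1

/-- Convergence in the weak topology is coordinatewise convergence for maps whose values have their
supports in a common finite set of vertices. -/
theorem tendsto_of_coord {ι : Type*} {l : Filter ι} {h : ι → Realization K} {x : Realization K}
    (F : Finset V) (hF : ∀ᶠ i in l, (h i).1.support ⊆ F)
    (hc : ∀ v, Tendsto (fun i => (h i).1 v) l (𝓝 (x.1 v))) : Tendsto h l (𝓝 x) := by
  rw [tendsto_nhds]
  intro U hU hxU
  -- Sorting the values by their exact support leaves finitely many cases. If that support misses a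
  -- vertex of `x`, the corresponding coordinate of `x` excludes it eventually; otherwise the
  -- Euclidean topology of one simplex decides.
  have key : ∀ σ ∈ F.powerset, ∀ᶠ i in l, (h i).1.support = σ → h i ∈ U := by
    intro σ _
    by_cases hσ : σ ∈ K.faces
    · by_cases hx : x.1.support ⊆ σ
      · have h1 := isOpen_iff.1 hU σ hσ
        obtain ⟨T, hT, hTU⟩ := isOpen_induced_iff.1 h1
        have h2 : Tendsto (fun i (v : σ) => (h i).1 v) l (𝓝 fun v : σ => x.1 v) :=
          tendsto_pi_nhds.2 fun v => hc v
        have h3 : (fun v : σ => x.1 v) ∈ T := by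
          have : (⟨x, hx⟩ : closedSimplex K σ) ∈ (Subtype.val ⁻¹' U : Set (closedSimplex K σ)) :=
            hxU
          rwa [← hTU] at this
        filter_upwards [h2 (hT.mem_nhds h3)] with i hi hs
        have : (⟨h i, hs.subset⟩ : closedSimplex K σ) ∈
            (Subtype.val ⁻¹' U : Set (closedSimplex K σ)) := by
          rw [← hTU]
          exact hi
        exact this
      · obtain ⟨v, hv, hvσ⟩ := Finset.not_subset.1 hx
        filter_upwards [(hc v).eventually_ne (Finsupp.mem_support_iff.1 hv)] with i hi hs
        exact absurd (hs ▸ Finsupp.mem_support_iff.2 hi) hvσ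
    · exact Eventually.of_forall fun i hi => absurd (hi ▸ (h i).2.2.2) hσ
  have h4 := (Filter.eventually_all_finset F.powerset).2 key
  filter_upwards [hF, h4] with i hi h5
  exact h5 _ (Finset.mem_powerset.2 hi) rfl

instance : T2Space (Realization K) :=
  T2Space.of_injective_continuous (f := fun (x : Realization K) v => x.1 v)
    (fun _ _ h => Subtype.ext (DFunLike.coe_injective h))
    (continuous_pi fun v => continuous_coord v)

/-- The weak topology tests closedness one simplex at a time, and finite sets are closed by the
Hausdorff property. -/
theorem isClosed_of_finite_inter {S : Set (Realization K)}
    (hS : ∀ σ ∈ K.faces, (S ∩ closedSimplex K σ).Finite) : IsClosed S := by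
  rw [← isOpen_compl_iff, isOpen_iff]
  intro σ hσ
  have h1 := isOpen_iff.1 (hS σ hσ).isClosed.isOpen_compl σ hσ
  convert h1 using 1
  ext x
  simp

/-- Choose for each vertex occurring in `A` a point of `A` that uses it. A simplex contains chosen
points for only finitely many vertices, so every set of chosen points is closed. The chosen points
thus form a closed discrete subset of a compact set, which is finite, and their supports cover all
vertices that occur. -/
theorem exists_finset_of_isCompact {A : Set (Realization K)} (hA : IsCompact A) :
    ∃ F : Finset V, ∀ x ∈ A, x.1.support ⊆ F := by
  classical
  have h : ∀ v : {v | ∃ x ∈ A, v ∈ x.1.support}, ∃ x ∈ A, (v : V) ∈ x.1.support := fun v => v.2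
  choose c hcA hc using h
  have hcl : ∀ S ⊆ Set.range c, IsClosed S := by
    refine fun S hS => isClosed_of_finite_inter fun σ _ => ?_
    have hfin : {v : {v | ∃ x ∈ A, v ∈ x.1.support} | (v : V) ∈ σ}.Finite :=
      σ.finite_toSet.preimage Subtype.val_injective.injOn
    refine (hfin.image c).subset ?_
    rintro x ⟨hx, hxσ⟩
    obtain ⟨v, rfl⟩ := hS hx
    exact ⟨v, hxσ (hc v), rfl⟩
  have hdisc : IsDiscrete (Set.range c) := by
    refine isDiscrete_iff_forall_mem_exists_isOpen.2 fun x hx => ?_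
    refine ⟨(Set.range c \ {x})ᶜ, (hcl _ Set.sdiff_subset).isOpen_compl, ?_⟩
    ext y
    simp only [Set.mem_inter_iff, Set.mem_compl_iff, Set.mem_sdiff, Set.mem_singleton_iff]
    constructor
    · rintro ⟨h1, h2⟩
      by_contra h3
      exact h1 ⟨h2, h3⟩
    · rintro rfl
      exact ⟨fun h => h.2 rfl, hx⟩
  have hcomp : IsCompact (Set.range c) :=
    hA.of_isClosed_subset (hcl _ subset_rfl) (Set.range_subset_iff.2 hcA)
  have hfin : (Set.range c).Finite := hcomp.finite hdisc
  refine ⟨hfin.toFinset.biUnion fun x => x.1.support, fun x hx v hv => ?_⟩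
  exact Finset.mem_biUnion.2 ⟨c ⟨v, x, hx, hv⟩, by simp, hc ⟨v, x, hx, hv⟩⟩

theorem vertex_support (v : V) : (vertex K v).1.support = {v} :=
  Finsupp.support_single _ one_ne_zero

theorem eq_vertex_of_support_subset {x : Realization K} {v : V} (h : x.1.support ⊆ {v}) :
    vertex K v = x := by
  obtain ⟨w, hw⟩ := exists_mem_support x
  have hs : x.1.support = {v} :=
    Finset.Subset.antisymm h (by simpa [Finset.mem_singleton.1 (h hw)] using hw)
  have h1 := x.2.2.1
  rw [hs, Finset.sum_singleton] at h1
  refine Subtype.ext (Finsupp.ext fun u => ?_)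
  by_cases hu : u = v
  · subst hu
    simp [vertex, h1]
  · have : x.1 u = 0 := by
      rw [← Finsupp.notMem_support_iff, hs]
      simpa using hu
    simp [vertex, this, Ne.symm hu]

end Realization

/-! ### Cliques, stars and neighborhoods in `R(G)` -/

namespace SimpleGraph

open Realization

variable {V : Type*} (G : SimpleGraph V)

theorem mem_vietorisRips_iff {σ : Finset V} : σ ∈ G.vietorisRips.faces ↔
    σ.Nonempty ∧ ∀ v ∈ σ, ∀ w ∈ σ, v = w ∨ G.Adj v w := by
  change (σ.Nonempty ∧ ∀ v ∈ σ, ∀ w ∈ σ, v ∈ G.cechClosure.cl {w}) ↔ _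
  simp [cechClosure, eq_comm, G.adj_comm]

theorem support_clique (x : G.VR) {v w : V} (hv : v ∈ x.1.support) (hw : w ∈ x.1.support) :
    v = w ∨ G.Adj v w :=
  (G.mem_vietorisRips_iff.1 x.2.2.2).2 v hv w hw

/-- In a clique complex, adding to a simplex a vertex adjacent to all its other vertices gives a
simplex, so star membership is a condition on edges. -/
theorem mem_closedStar_iff {x : G.VR} {v : V} :
    x ∈ closedStar G.vietorisRips v ↔ ∀ w ∈ x.1.support, v = w ∨ G.Adj v w := by
  classical
  simp only [closedStar, Set.mem_iUnion, closedSimplex, Set.mem_ofPred_eq]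
  constructor
  · rintro ⟨σ, ⟨hσ, hv⟩, hx⟩ w hw
    exact (G.mem_vietorisRips_iff.1 hσ).2 v hv w (hx hw)
  · intro h
    refine ⟨insert v x.1.support, ⟨G.mem_vietorisRips_iff.2 ⟨by simp, ?_⟩, by simp⟩,
      Finset.subset_insert _ _⟩
    intro a ha b hb
    rcases Finset.mem_insert.1 ha with rfl | ha' <;>
      rcases Finset.mem_insert.1 hb with rfl | hb'
    · exact Or.inl rfl
    · exact h b hb'
    · exact (h a ha').imp Eq.symm SimpleGraph.Adj.symm
    · exact G.support_clique x ha' hb'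

/-- Off the vertices this holds because a nonzero coordinate stays nonzero. It allows any vertex of
the support of `f y` to serve as `ψ y`. -/
theorem closedStar_mem_nhdR {x : G.VR} {v : V} (hv : v ∈ x.1.support) :
    closedStar G.vietorisRips v ∈ G.nhdR x := by
  by_cases h : ∃ w, vertex G.vietorisRips w = x
  · obtain ⟨w, rfl⟩ := h
    rw [vertex_support, Finset.mem_singleton] at hv
    rw [nhdR_vertex, hv]
    exact mem_principal_self _
  · rw [nhdR_of_ne_vertex G x (by simpa using h)]
    have h1 : ∀ᶠ y : G.VR in 𝓝 x, y.1 v ≠ 0 :=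
      (continuous_coord v).continuousAt.eventually_ne (Finsupp.mem_support_iff.1 hv)
    filter_upwards [h1] with y hy
    exact G.mem_closedStar_iff.2 fun w hw =>
      G.support_clique y (Finsupp.mem_support_iff.2 hy) hw

/-- A non-vertex has two nonzero coordinates, and both stay nonzero nearby. -/
theorem eventually_ne_vertex {x : G.VR} (hx : ∀ v, vertex G.vietorisRips v ≠ x) :
    ∀ᶠ y in 𝓝 x, ∀ v, vertex G.vietorisRips v ≠ y := by
  obtain ⟨v, hv⟩ := exists_mem_support x
  obtain ⟨w, hw, hwv⟩ : ∃ w ∈ x.1.support, w ≠ v := by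
    by_contra! h
    exact hx v (eq_vertex_of_support_subset fun w hw => Finset.mem_singleton.2 (h w hw))
  have hc := fun u : V => (continuous_coord (K := G.vietorisRips) u).continuousAt (x := x)
  filter_upwards [(hc v).eventually_ne (Finsupp.mem_support_iff.1 hv),
    (hc w).eventually_ne (Finsupp.mem_support_iff.1 hw)] with y hyv hyw u hu
  rw [← Finsupp.mem_support_iff, ← hu, vertex_support, Finset.mem_singleton] at hyv hyw
  exact hwv (hyw.trans hyv.symm)

/-- A finitely supported system of nonnegative weights on a clique determines, after division by the
total weight, a point of the realization. -/
theorem exists_normalized (z : V →₀ ℝ) (h0 : ∀ v, 0 ≤ z v)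
    (hc : ∀ v ∈ z.support, ∀ w ∈ z.support, v = w ∨ G.Adj v w) {S : ℝ} (hS : 0 < S)
    (hsum : Finsupp.linearCombination ℝ (fun _ => (1 : ℝ)) z = S) :
    ∃ k : G.VR, ∀ v, k.1 v = z v / S := by
  have hsum' : ∑ v ∈ z.support, z v = S := by
    simpa [Finsupp.linearCombination_apply, Finsupp.sum] using hsum
  have hsupp : (S⁻¹ • z).support = z.support := Finsupp.support_smul_eq (inv_ne_zero hS.ne')
  refine ⟨⟨S⁻¹ • z, fun v => ?_, ?_, ?_⟩, fun v => ?_⟩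
  · exact mul_nonneg (inv_nonneg.2 hS.le) (h0 v)
  · rw [hsupp]
    simp only [Finsupp.smul_apply, smul_eq_mul]
    rw [← Finset.mul_sum, hsum', inv_mul_cancel₀ hS.ne']
  · rw [hsupp]
    refine G.mem_vietorisRips_iff.2 ⟨?_, hc⟩
    by_contra h
    rw [Finset.not_nonempty_iff_eq_empty.1 h] at hsum'
    exact hS.ne (by simpa using hsum')
  · simp [div_eq_inv_mul]

end SimpleGraph

/-! ### Construction of the homotopy -/

namespace SimpleGraph

open Realization

variable {V Y : Type*} (G : SimpleGraph V)

/-- The normalized sums of `f y` and of the vertices `φ i`, with weights `α y + (1 - τ)` and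
`τ * b i y`. -/
theorem exists_interpolation {ι : Type*} (f : Y → G.VR) (α : Y → ℝ) (t : Finset ι) (φ : ι → V)
    (b : ι → Y → ℝ) (hα : ∀ y, 0 ≤ α y) (hb : ∀ i y, 0 ≤ b i y)
    (hpos : ∀ y, 0 < α y + ∑ i ∈ t, b i y)
    (hφf : ∀ y, ∀ i ∈ t, 0 < b i y → ∀ w ∈ (f y).1.support, φ i = w ∨ G.Adj (φ i) w)
    (hφφ : ∀ y, ∀ i ∈ t, ∀ j ∈ t, 0 < b i y → 0 < b j y → φ i = φ j ∨ G.Adj (φ i) (φ j)) :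
    ∃ k : Y → unitInterval → G.VR, ∀ y τ v, (k y τ).1 v =
      ((α y + (1 - (τ : ℝ))) * (f y).1 v + τ * ∑ i ∈ t, Finsupp.single (φ i) (b i y) v) /
        ((α y + (1 - (τ : ℝ))) + τ * ∑ i ∈ t, b i y) := by
  classical
  have h : ∀ y (τ : unitInterval), ∃ k : G.VR, ∀ v, k.1 v =
      ((α y + (1 - (τ : ℝ))) * (f y).1 v + τ * ∑ i ∈ t, Finsupp.single (φ i) (b i y) v) /
        ((α y + (1 - (τ : ℝ))) + τ * ∑ i ∈ t, b i y) := by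
    intro y τ
    have hτ0 := τ.2.1
    have hτ1 := τ.2.2
    have hs : ∀ i v, 0 ≤ Finsupp.single (φ i) (b i y) v := fun i v => by
      rw [Finsupp.single_apply]
      split_ifs
      exacts [hb i y, le_rfl]
    have hB : 0 ≤ ∑ i ∈ t, b i y := Finset.sum_nonneg fun i _ => hb i y
    have hmem : ∀ v ∈ ((α y + (1 - (τ : ℝ))) • (f y).1 +
        (τ : ℝ) • ∑ i ∈ t, Finsupp.single (φ i) (b i y)).support,
        v ∈ (f y).1.support ∨ ∃ i ∈ t, 0 < b i y ∧ φ i = v := by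
      intro v hv
      by_contra! hcon
      refine Finsupp.mem_support_iff.1 hv ?_
      have h1 : ∑ i ∈ t, Finsupp.single (φ i) (b i y) v = 0 := by
        refine Finset.sum_eq_zero fun i hi => ?_
        rw [Finsupp.single_apply]
        split_ifs with hiv
        · exact le_antisymm (not_lt.1 fun hlt => hcon.2 i hi hlt hiv) (hb i y)
        · rfl
      simp [h1, Finsupp.notMem_support_iff.1 hcon.1]
    have hz0 : ∀ v, 0 ≤ ((α y + (1 - (τ : ℝ))) • (f y).1 +
        (τ : ℝ) • ∑ i ∈ t, Finsupp.single (φ i) (b i y)) v := by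
      intro v
      simp only [Finsupp.add_apply, Finsupp.smul_apply, smul_eq_mul, Finsupp.finsetSum_apply]
      have h1 : 0 ≤ α y + (1 - (τ : ℝ)) := by linarith [hα y]
      exact add_nonneg (mul_nonneg h1 ((f y).2.1 v))
        (mul_nonneg hτ0 (Finset.sum_nonneg fun i _ => hs i v))
    have hS : 0 < (α y + (1 - (τ : ℝ))) + τ * ∑ i ∈ t, b i y := by
      rcases hτ1.lt_or_eq with h1 | h1
      · have := mul_nonneg hτ0 hB
        linarith [hα y]
      · rw [h1]
        linarith [hpos y]
    have hclique : ∀ v ∈ ((α y + (1 - (τ : ℝ))) • (f y).1 +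
        (τ : ℝ) • ∑ i ∈ t, Finsupp.single (φ i) (b i y)).support,
        ∀ w ∈ ((α y + (1 - (τ : ℝ))) • (f y).1 +
          (τ : ℝ) • ∑ i ∈ t, Finsupp.single (φ i) (b i y)).support, v = w ∨ G.Adj v w := by
      intro v hv w hw
      rcases hmem v hv with hv | ⟨i, hi, hbi, rfl⟩ <;> rcases hmem w hw with hw | ⟨j, hj, hbj, rfl⟩
      · exact G.support_clique _ hv hw
      · exact (hφf y j hj hbj v hv).imp Eq.symm SimpleGraph.Adj.symm
      · exact hφf y i hi hbi w hw
      · exact hφφ y i hi j hj hbi hbj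
    have h1 : Finsupp.linearCombination ℝ (fun _ => (1 : ℝ)) (f y).1 = 1 := by
      refine Eq.trans ?_ (f y).2.2.1
      simp [Finsupp.linearCombination_apply, Finsupp.sum]
    obtain ⟨k, hk⟩ := G.exists_normalized _ hz0 hclique hS (by simp [h1, map_sum])
    refine ⟨k, fun v => ?_⟩
    rw [hk v]
    simp
  choose k hk using h
  exact ⟨k, hk⟩

/-- A map `f` which is continuous into `R(G)` is homotopic to a continuous map into `|VR(G)|` which
is a combination of `f`, on an open set where `f` is continuous into `|VR(G)|`, and of
vertices. -/
theorem exists_homotopy_of_weights [TopologicalSpace Y] {ι : Type*} (f : Y → G.VR)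
    (hf : ∀ y, Tendsto f (𝓝 y) (G.nhdR (f y))) {C : Set Y} (hC : IsClosed C)
    (hfC : ∀ y ∉ C, Tendsto f (𝓝 y) (𝓝 (f y))) (F : Finset V)
    (hF : ∀ y ∉ C, (f y).1.support ⊆ F) (ψ : Y → V) (hψ : ∀ y, ψ y ∈ (f y).1.support)
    (α : Y → ℝ) (t : Finset ι) (φ : ι → V)
    (b : ι → Y → ℝ) (hαc : Continuous α) (hbc : ∀ i, Continuous (b i))
    (hαC : ∀ y ∈ C, ∀ᶠ z in 𝓝 y, α z = 0)
    (hα : ∀ y, 0 ≤ α y) (hb : ∀ i y, 0 ≤ b i y)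
    (hpos : ∀ y, 0 < α y + ∑ i ∈ t, b i y)
    (hφf : ∀ y, ∀ i ∈ t, 0 < b i y → ∀ w ∈ (f y).1.support, φ i = w ∨ G.Adj (φ i) w)
    (hφφ : ∀ y, ∀ i ∈ t, ∀ j ∈ t, 0 < b i y → 0 < b j y → φ i = φ j ∨ G.Adj (φ i) (φ j))
    (hψφ : ∀ y, ∀ᶠ z in 𝓝 y, ∀ i ∈ t, 0 < b i z → ψ y = φ i ∨ G.Adj (ψ y) (φ i))
    (s : Y) (hsC : s ∈ C → vertex G.vietorisRips (ψ s) = f s)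
    (hst : ∀ i ∈ t, 0 < b i s → vertex G.vietorisRips (φ i) = f s) :
    ∃ (g : Y → G.VR) (H : Y × unitInterval → G.VR), (∀ y, Tendsto g (𝓝 y) (𝓝 (g y))) ∧
      (∀ y r, Tendsto H (𝓝 y ×ˢ 𝓝 r) (G.nhdR (H (y, r)))) ∧ (∀ y, H (y, 0) = f y) ∧
      (∀ y, H (y, 1) = g y) ∧ (∀ r, H (s, r) = f s) ∧ g s = f s := by
  classical
  obtain ⟨k, hk⟩ := G.exists_interpolation f α t φ b hα hb hpos hφf hφφ
  have hB : ∀ y, 0 ≤ ∑ i ∈ t, b i y := fun y => Finset.sum_nonneg fun i _ => hb i y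
  have hden : ∀ y (τ : unitInterval), 0 < (α y + (1 - (τ : ℝ))) + τ * ∑ i ∈ t, b i y := by
    intro y τ
    rcases τ.2.2.lt_or_eq with h1 | h1
    · have := mul_nonneg τ.2.1 (hB y)
      linarith [hα y]
    · rw [h1]
      linarith [hpos y]
  have hsuppb : ∀ y v, (∑ i ∈ t, Finsupp.single (φ i) (b i y) v) ≠ 0 →
      ∃ i ∈ t, 0 < b i y ∧ φ i = v := by
    intro y v h
    obtain ⟨i, hi, hne⟩ := Finset.exists_ne_zero_of_sum_ne_zero h
    rw [Finsupp.single_apply] at hne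
    split_ifs at hne with hiv
    · exact ⟨i, hi, (hb i y).lt_of_ne hne.symm, hiv⟩
    · exact absurd rfl hne
  have hsupp : ∀ y τ, ∀ v ∈ (k y τ).1.support,
      v ∈ (f y).1.support ∨ ∃ i ∈ t, 0 < b i y ∧ φ i = v := by
    intro y τ v hv
    rw [Finsupp.mem_support_iff, hk] at hv
    by_contra! hcon
    refine hv ?_
    have h1 : ∑ i ∈ t, Finsupp.single (φ i) (b i y) v = 0 := by
      by_contra h
      obtain ⟨i, hi, hbi, hiv⟩ := hsuppb y v h
      exact hcon.2 i hi hbi hiv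
    rw [h1, Finsupp.notMem_support_iff.1 hcon.1]
    simp
  have hk0 : ∀ y, k y 0 = f y := by
    intro y
    refine Subtype.ext (Finsupp.ext fun v => ?_)
    have : α y + 1 ≠ 0 := by linarith [hα y]
    rw [hk]
    simp [this]
  -- Every term with positive weight at `s` is `f s` itself, so the interpolation does not move.
  have hks : ∀ τ, k s τ = f s := by
    intro τ
    refine Subtype.ext (Finsupp.ext fun v => ?_)
    have h1 : ∑ i ∈ t, Finsupp.single (φ i) (b i s) v = (∑ i ∈ t, b i s) * (f s).1 v := by
      rw [Finset.sum_mul]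
      refine Finset.sum_congr rfl fun i hi => ?_
      rcases (hb i s).lt_or_eq with h | h
      · rw [← hst i hi h]
        simp [vertex, Finsupp.single_apply]
      · simp [← h]
    rw [hk, h1, div_eq_iff (hden s τ).ne']
    ring
  have hsingle : ∀ v y, Tendsto (fun z => ∑ i ∈ t, Finsupp.single (φ i) (b i z) v) (𝓝 y)
      (𝓝 (∑ i ∈ t, Finsupp.single (φ i) (b i y) v)) := by
    refine fun v y => tendsto_finsetSum _ fun i _ => ?_
    simp only [Finsupp.single_apply]
    split_ifs
    · exact (hbc i).tendsto y
    · exact tendsto_const_nhds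
  have hsum : ∀ y, Tendsto (fun z => ∑ i ∈ t, b i z) (𝓝 y) (𝓝 (∑ i ∈ t, b i y)) :=
    fun y => tendsto_finsetSum _ fun i _ => (hbc i).tendsto y
  have hkC : ∀ y ∉ C, ∀ τ, Tendsto (fun q : Y × unitInterval => k q.1 q.2) (𝓝 y ×ˢ 𝓝 τ)
      (𝓝 (k y τ)) := by
    intro y hy τ
    refine tendsto_of_coord (F ∪ t.image φ) ?_ fun v => ?_
    · have : ∀ᶠ q : Y × unitInterval in 𝓝 y ×ˢ 𝓝 τ, q.1 ∉ C :=
        tendsto_fst.eventually (hC.isOpen_compl.mem_nhds hy)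
      filter_upwards [this] with q hq v hv
      rcases hsupp _ _ v hv with h | ⟨i, hi, _, rfl⟩
      · exact Finset.mem_union_left _ (hF _ hq h)
      · exact Finset.mem_union_right _ (Finset.mem_image_of_mem _ hi)
    · simp only [hk]
      have hτ : Tendsto (fun q : Y × unitInterval => (q.2 : ℝ)) (𝓝 y ×ˢ 𝓝 τ) (𝓝 (τ : ℝ)) :=
        (continuous_subtype_val.tendsto τ).comp tendsto_snd
      have ha : Tendsto (fun q : Y × unitInterval => α q.1 + (1 - (q.2 : ℝ))) (𝓝 y ×ˢ 𝓝 τ)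
          (𝓝 (α y + (1 - (τ : ℝ)))) :=
        ((hαc.tendsto y).comp tendsto_fst).add (tendsto_const_nhds.sub hτ)
      have hfv : Tendsto (fun q : Y × unitInterval => (f q.1).1 v) (𝓝 y ×ˢ 𝓝 τ)
          (𝓝 ((f y).1 v)) :=
        (((continuous_coord v).tendsto (f y)).comp (hfC y hy)).comp tendsto_fst
      exact ((ha.mul hfv).add (hτ.mul ((hsingle v y).comp tendsto_fst))).div
        (ha.add (hτ.mul ((hsum y).comp tendsto_fst))) (hden y τ).ne'
  have hg : ∀ y, Tendsto (fun z => k z 1) (𝓝 y) (𝓝 (k y 1)) := by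
    intro y
    by_cases hy : y ∈ C
    -- Here `f` may be discontinuous into `|VR(G)|`, but its weight at time 1 is `α`, which vanishes
    -- near `y`.
    · have h0 := hαC y hy
      have hk1 : ∀ z, α z = 0 → ∀ v, (k z 1).1 v =
          (∑ i ∈ t, Finsupp.single (φ i) (b i z) v) / ∑ i ∈ t, b i z := by
        intro z hz v
        rw [hk]
        simp [hz]
      refine tendsto_of_coord (t.image φ) ?_ fun v => ?_
      · filter_upwards [h0] with z hz v hv
        rw [Finsupp.mem_support_iff, hk1 z hz] at hv
        obtain ⟨i, hi, _, rfl⟩ := hsuppb z v (div_ne_zero_iff.1 hv).1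
        exact Finset.mem_image_of_mem _ hi
      · have hy0 := h0.self_of_nhds
        rw [hk1 y hy0]
        have hne : ∑ i ∈ t, b i y ≠ 0 := by
          have := hpos y
          rw [hy0, zero_add] at this
          exact this.ne'
        refine ((hsingle v y).div (hsum y) hne).congr' ?_
        filter_upwards [h0] with z hz
        exact (hk1 z hz v).symm
    · exact (hkC y hy 1).comp (tendsto_id.prodMk tendsto_const_nhds)
  -- Time rests at 0 up to 1/3 and at 1 from 2/3 on, so intermediate interpolations over `C` occur
  -- only inside `D`, where they are overwritten.
  let θ : unitInterval → unitInterval := fun r => Set.projIcc 0 1 zero_le_one (3 * (r : ℝ) - 1)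
  have hθ : Continuous θ := continuous_projIcc.comp (by fun_prop)
  have hθ0 : ∀ r : unitInterval, (r : ℝ) ≤ 1 / 3 → θ r = 0 :=
    fun r hr => Set.projIcc_of_le_left _ (by linarith)
  have hθ1 : ∀ r : unitInterval, 2 / 3 ≤ (r : ℝ) → θ r = 1 :=
    fun r hr => Set.projIcc_of_right_le _ (by linarith)
  let D : Set (Y × unitInterval) :=
    {q | q.1 ∈ C ∧ 1 / 3 ≤ (q.2 : ℝ) ∧ (q.2 : ℝ) ≤ 2 / 3}
  have hsnd : Continuous fun q : Y × unitInterval => (q.2 : ℝ) := by fun_prop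
  have hD : IsClosed D := (hC.preimage continuous_fst).inter
    ((isClosed_le continuous_const hsnd).inter (isClosed_le hsnd continuous_const))
  let H : Y × unitInterval → G.VR := fun q =>
    if q ∈ D then vertex G.vietorisRips (ψ q.1) else k q.1 (θ q.2)
  refine ⟨fun y => k y 1, H, hg, fun y r => ?_, fun y => ?_, fun y => ?_, fun r => ?_, hks 1⟩
  · by_cases hyr : (y, r) ∈ D
    · have hstar : ∀ᶠ z in 𝓝 y, f z ∈ closedStar G.vietorisRips (ψ y) :=
        hf y (G.closedStar_mem_nhdR (hψ y))
      have hH : H (y, r) = vertex G.vietorisRips (ψ y) := if_pos hyr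
      rw [hH, nhdR_vertex, tendsto_principal]
      -- Each nearby value is supported on vertices of `f q.1` and active vertices `φ i`, all equal
      -- or adjacent to `ψ y`.
      filter_upwards [tendsto_fst.eventually hstar, tendsto_fst.eventually (hψφ y)] with q h1 h2
      rw [mem_closedStar_iff] at h1 ⊢
      intro w hw
      by_cases hq : q ∈ D
      · rw [show H q = vertex G.vietorisRips (ψ q.1) from if_pos hq, vertex_support,
          Finset.mem_singleton] at hw
        exact h1 w (hw ▸ hψ q.1)
      · rw [show H q = k q.1 (θ q.2) from if_neg hq] at hw
        rcases hsupp _ _ w hw with h | ⟨i, hi, hbi, rfl⟩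
        · exact h1 w h
        · exact h2 i hi hbi
    · have hH : H (y, r) = k y (θ r) := if_neg hyr
      have hev : ∀ᶠ q in 𝓝 y ×ˢ 𝓝 r, H q = k q.1 (θ q.2) := by
        rw [← nhds_prod_eq]
        filter_upwards [hD.isOpen_compl.mem_nhds hyr] with q hq
        exact if_neg hq
      rw [hH]
      refine Tendsto.congr' (f₁ := fun q => k q.1 (θ q.2)) (hev.mono fun q hq => hq.symm) ?_
      by_cases hy : y ∈ C
      · have hr : (r : ℝ) < 1 / 3 ∨ 2 / 3 < (r : ℝ) := by
          by_contra! hcon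
          exact hyr ⟨hy, hcon⟩
        rcases hr with hr | hr
        · have hev' : ∀ᶠ q : Y × unitInterval in 𝓝 y ×ˢ 𝓝 r, (q.2 : ℝ) < 1 / 3 :=
            tendsto_snd.eventually
              ((continuous_subtype_val.tendsto r).eventually (gt_mem_nhds hr))
          rw [hθ0 r hr.le, hk0]
          refine ((hf y).comp tendsto_fst).congr' ?_
          filter_upwards [hev'] with q hq
          rw [hθ0 q.2 hq.le, hk0, Function.comp]
        · have hev' : ∀ᶠ q : Y × unitInterval in 𝓝 y ×ˢ 𝓝 r, 2 / 3 < (q.2 : ℝ) :=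
            tendsto_snd.eventually
              ((continuous_subtype_val.tendsto r).eventually (lt_mem_nhds hr))
          rw [hθ1 r hr.le]
          refine (((hg y).comp tendsto_fst).congr' ?_).mono_right (G.nhds_le_nhdR _)
          filter_upwards [hev'] with q hq
          rw [hθ1 q.2 hq.le, Function.comp]
      · exact ((hkC y hy (θ r)).comp
          (tendsto_fst.prodMk ((hθ.tendsto r).comp tendsto_snd))).mono_right (G.nhds_le_nhdR _)
  · have h0 : (y, (0 : unitInterval)) ∉ D := fun h => by
      have := h.2.1
      norm_num at this
    rw [show H (y, 0) = k y (θ 0) from if_neg h0, hθ0 0 (by norm_num), hk0]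
  · have h1 : (y, (1 : unitInterval)) ∉ D := fun h => by
      have := h.2.2
      norm_num at this
    rw [show H (y, 1) = k y (θ 1) from if_neg h1, hθ1 1 (by norm_num)]
  · by_cases h : (s, r) ∈ D
    · rw [show H (s, r) = vertex G.vietorisRips (ψ s) from if_pos h, hsC h.1]
    · rw [show H (s, r) = k s (θ r) from if_neg h, hks]

/-- Every map of a compact metric space into `R(G)` is homotopic relative to a given base point to a
continuous map into `|VR(G)|`. -/
theorem exists_based_homotopy [MetricSpace Y] [CompactSpace Y] (f : Y → G.VR)
    (hf : ∀ y, Tendsto f (𝓝 y) (G.nhdR (f y))) (s : Y) :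
    ∃ (g : Y → G.VR) (H : Y × unitInterval → G.VR), (∀ y, Tendsto g (𝓝 y) (𝓝 (g y))) ∧
      (∀ y r, Tendsto H (𝓝 y ×ˢ 𝓝 r) (G.nhdR (H (y, r)))) ∧ (∀ y, H (y, 0) = f y) ∧
      (∀ y, H (y, 1) = g y) ∧ (∀ r, H (s, r) = f s) ∧ g s = f s := by
  choose ψ hψ using fun y => exists_mem_support (f y)
  -- The second condition makes every bump centered away from `s` vanish at `s`.
  have hδ : ∀ x, ∃ δ > 0, (∀ y, Dist.dist y x < δ → f y ∈ closedStar G.vietorisRips (ψ x)) ∧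
      (x ≠ s → δ ≤ Dist.dist s x) := by
    intro x
    obtain ⟨δ, hδ, h⟩ := Metric.eventually_nhds_iff.1
      (hf x (G.closedStar_mem_nhdR (hψ x)) : ∀ᶠ y in 𝓝 x, f y ∈ closedStar G.vietorisRips (ψ x))
    by_cases hx : x = s
    · exact ⟨δ, hδ, fun y hy => h hy, fun hne => absurd hx hne⟩
    · refine ⟨min δ (Dist.dist s x), lt_min hδ (dist_pos.2 (Ne.symm hx)),
        fun y hy => h (hy.trans_le (min_le_left _ _)), fun _ => min_le_right _ _⟩
  choose δ hδ0 hδ hδs using hδ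
  -- The radius is halved so that centers of overlapping bumps are closer than the larger of the two
  -- `δ`.
  let b : Y → Y → ℝ := fun x y => max 0 (δ x / 2 - Dist.dist y x)
  have hbc : ∀ x, Continuous (b x) := fun x => by fun_prop
  have hb0 : ∀ x y, 0 ≤ b x y := fun x y => le_max_left _ _
  have hbpos : ∀ x y, 0 < b x y ↔ Dist.dist y x < δ x / 2 := fun x y => by simp [b]
  have hbs : ∀ x, 0 < b x s → x = s := by
    intro x hx
    by_contra hne
    have h1 := (hbpos x s).1 hx
    linarith [hδs x hne, hδ0 x]
  have hψf : ∀ y x, 0 < b x y → ∀ w ∈ (f y).1.support, ψ x = w ∨ G.Adj (ψ x) w := by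
    intro y x hx
    exact G.mem_closedStar_iff.1 (hδ x y (by linarith [(hbpos x y).1 hx, hδ0 x]))
  have hnear : ∀ x y, Dist.dist x y < δ x / 2 + δ y / 2 → ψ x = ψ y ∨ G.Adj (ψ x) (ψ y) := by
    intro x y h
    rcases le_total (δ x) (δ y) with h1 | h1
    · exact (G.mem_closedStar_iff.1 (hδ y x (by linarith)) _ (hψ x)).imp Eq.symm
        SimpleGraph.Adj.symm
    · exact G.mem_closedStar_iff.1 (hδ x y (by rw [_root_.dist_comm]; linarith)) _ (hψ y)
  have hψψ : ∀ z x y, Dist.dist z x < δ x / 2 → Dist.dist z y < δ y / 2 → ψ x = ψ y ∨ G.Adj (ψ x) (ψ y) :=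
    fun z x y hx hy => hnear x y (by linarith [dist_triangle_left x y z])
  have hψb : ∀ y, ∀ᶠ z in 𝓝 y, ∀ x, 0 < b x z → ψ y = ψ x ∨ G.Adj (ψ y) (ψ x) := by
    intro y
    filter_upwards [Metric.ball_mem_nhds y (half_pos (hδ0 y))] with z hz x hx
    exact hψψ z y x hz ((hbpos x z).1 hx)
  have hcover : ∀ A : Set Y, IsCompact A → ∃ t : Finset Y, (∀ x ∈ t, x ∈ A) ∧
      ∀ y ∈ A, 0 < ∑ x ∈ t, b x y := by
    intro A hA
    obtain ⟨t, htA, ht⟩ := hA.elim_nhds_subcover (fun x => Metric.ball x (δ x / 2))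
      fun x _ => Metric.ball_mem_nhds x (half_pos (hδ0 x))
    refine ⟨t, htA, fun y hy => ?_⟩
    obtain ⟨x, hx, hyx⟩ := Set.mem_iUnion₂.1 (ht hy)
    exact Finset.sum_pos' (fun x _ => hb0 x y) ⟨x, hx, (hbpos x y).2 hyx⟩
  by_cases hp : ∃ v, vertex G.vietorisRips v = f s
  · obtain ⟨v, hv⟩ := hp
    have hψs : vertex G.vietorisRips (ψ s) = f s := by
      have := hψ s
      rw [← hv, vertex_support, Finset.mem_singleton] at this
      rw [this, hv]
    obtain ⟨t, -, ht⟩ := hcover Set.univ isCompact_univ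
    -- With `C` the whole space and `α = 0`, no continuity of `f` into `|VR(G)|` is needed.
    refine G.exists_homotopy_of_weights f hf isClosed_univ (fun y hy => absurd trivial hy) ∅
      (fun y hy => absurd trivial hy) ψ hψ (fun _ => 0) t ψ b continuous_const hbc
      (fun _ _ => Eventually.of_forall fun _ => rfl) (fun _ => le_rfl) hb0
      (fun y => by simpa using ht y trivial) (fun y x _ => hψf y x)
      (fun z x _ y _ hx hy => hψψ z x y ((hbpos x z).1 hx) ((hbpos y z).1 hy))
      (fun y => (hψb y).mono fun z hz x _ => hz x) s (fun _ => hψs) fun x _ hx => ?_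
    rw [hbs x hx, hψs]
  · push Not at hp
    have hfs : ∀ᶠ y in 𝓝 s, ∀ v, vertex G.vietorisRips v ≠ f y := by
      have h1 := hf s
      rw [nhdR_of_ne_vertex G _ hp] at h1
      exact h1.eventually (G.eventually_ne_vertex hp)
    obtain ⟨r, hr, hrs⟩ := Metric.nhds_basis_closedBall.eventually_iff.1 hfs
    have hfc : ∀ y ∈ Metric.closedBall s r, Tendsto f (𝓝 y) (𝓝 (f y)) := by
      intro y hy
      have h1 := hf y
      rwa [nhdR_of_ne_vertex G _ (hrs hy)] at h1
    obtain ⟨F, hF⟩ := exists_finset_of_isCompact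
      ((isCompact_closedBall s r).image_of_continuousOn
        fun y hy => ContinuousAt.continuousWithinAt (hfc y hy))
    -- Centers at distance at least `r / 2` keep all chosen bumps zero at `s`; the remaining ball is
    -- covered by `α`, which is positive exactly there.
    obtain ⟨t, htA, ht⟩ := hcover {y | r / 2 ≤ Dist.dist y s}
      (isClosed_le continuous_const (by fun_prop)).isCompact
    have hball : ∀ y ∉ {y | r ≤ Dist.dist y s}, y ∈ Metric.closedBall s r :=
      fun y hy => Metric.mem_closedBall.2 (lt_of_not_ge hy).le
    have hbs' : ∀ x ∈ t, ¬ 0 < b x s := by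
      intro x hx h
      have h1 : r / 2 ≤ Dist.dist x s := htA x hx
      rw [hbs x h, _root_.dist_self] at h1
      linarith
    refine G.exists_homotopy_of_weights f hf (C := {y | r ≤ Dist.dist y s})
      (isClosed_le continuous_const (by fun_prop)) (fun y hy => hfc y (hball y hy)) F
      (fun y hy => hF _ ⟨y, hball y hy, rfl⟩) ψ hψ (fun y => max 0 (r / 2 - Dist.dist y s)) t ψ b
      (by fun_prop) hbc (fun y hy => ?_) (fun _ => le_max_left _ _) hb0 (fun y => ?_)
      (fun y x _ => hψf y x)
      (fun z x _ y _ hx hy => hψψ z x y ((hbpos x z).1 hx) ((hbpos y z).1 hy))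
      (fun y => (hψb y).mono fun z hz x _ => hz x) s (fun h => ?_)
      fun x hx h => absurd h (hbs' x hx)
    · have h1 : Tendsto (fun z => Dist.dist z s) (𝓝 y) (𝓝 (Dist.dist y s)) :=
        (by fun_prop : Continuous fun z => Dist.dist z s).tendsto y
      have h2 : r / 2 < Dist.dist y s := lt_of_lt_of_le (half_lt_self hr) hy
      filter_upwards [h1.eventually (lt_mem_nhds h2)] with z hz
      exact max_eq_left (by linarith)
    · by_cases hy : r / 2 ≤ Dist.dist y s
      · exact add_pos_of_nonneg_of_pos (le_max_left _ _) (ht y hy)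
      · exact add_pos_of_pos_of_nonneg (lt_max_of_lt_right (by linarith))
          (Finset.sum_nonneg fun x _ => hb0 x y)
    · have h1 : r ≤ Dist.dist s s := h
      rw [_root_.dist_self] at h1
      linarith

end SimpleGraph

theorem mainTheorem2 {V : Type*} (G : SimpleGraph V) (n : ℕ) :
    (∀ f : CechClosure.Sphere n → G.VR,
      (CechClosure.ofTop (CechClosure.Sphere n)).Continuous G.closureR f →
        ∃ g : CechClosure.Sphere n → G.VR,
          (CechClosure.ofTop (CechClosure.Sphere n)).Continuous G.closureVR g ∧
            (CechClosure.ofTop (CechClosure.Sphere n)).Homotopic G.closureR f (id ∘ g)) ∧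
    ∀ (s : CechClosure.Sphere n) (p : G.VR),
      (∀ f : CechClosure.BasedMap (CechClosure.ofTop (CechClosure.Sphere n)) s G.closureR p,
        ∃ g : CechClosure.BasedMap (CechClosure.ofTop (CechClosure.Sphere n)) s G.closureVR p,
          f.Homotopic (g.postcomp (G.idVR p))) ∧
      Function.Surjective (CechClosure.HomotopyClasses.map n s (G.idVR p)) := by
  have hR : ∀ x, G.closureR.nhd x = G.nhdR x := CechClosure.nhd_ofNhds _ _
  have based : ∀ (s : CechClosure.Sphere n) (p : G.VR)
      (f : CechClosure.BasedMap (CechClosure.ofTop (CechClosure.Sphere n)) s G.closureR p),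
      ∃ g : CechClosure.BasedMap (CechClosure.ofTop (CechClosure.Sphere n)) s G.closureVR p,
        f.Homotopic (g.postcomp (G.idVR p)) := by
    intro s p f
    have hf := CechClosure.continuous_iff.1 f.continuous
    simp only [CechClosure.nhd_ofTop, hR] at hf
    obtain ⟨g, H, hg, hH, h0, h1, hs, hgs⟩ := G.exists_based_homotopy f.toFun hf s
    rw [f.map_base] at hgs
    simp only [f.map_base] at hs
    refine ⟨⟨g, CechClosure.continuous_iff.2 fun y => ?_, hgs⟩, H,
      CechClosure.continuous_prod_iff.2 fun y r => ?_, h0, h1, hs⟩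
    · rw [SimpleGraph.closureVR, CechClosure.nhd_ofTop, CechClosure.nhd_ofTop]
      exact hg y
    · rw [CechClosure.nhd_ofTop, hR]
      exact hH y r
  refine ⟨fun f hf => ?_, fun s p => ⟨based s p, ?_⟩⟩
  · obtain ⟨s⟩ : Nonempty (CechClosure.Sphere n) :=
      (NormedSpace.sphere_nonempty.2 zero_le_one).to_subtype
    -- The free statement is the based one at an arbitrary point `s`, with base value `f s`.
    obtain ⟨g, H, hH, h0, h1, -⟩ := based s (f s) ⟨f, hf, rfl⟩
    exact ⟨g.toFun, g.continuous, H, hH, h0, h1⟩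
  · intro q
    induction q using Quotient.inductionOn with
    | h f =>
      obtain ⟨g, hg⟩ := based s p f
      exact ⟨Quotient.mk _ g, Quotient.sound hg.symm⟩
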